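/- Let $L/K$ be an extension of number fields, with rings of integers $A\subseteq B$ ($A$ that of $K$, $B$ that of $L$), and write $\mathrm{fgMod}(R)$ for the category of finitely generated $R$-modules. Let $T$ be the monad on $\mathrm{fgMod}(A)$ associated to the adjunction between extension of scalars $\mathrm{fgMod}(A)\to\mathrm{fgMod}(B)$ and restriction of scalars $\mathrm{fgMod}(B)\to\mathrm{fgMod}(A)$, so that $T(M)$ is the underlying $A$-module of $B\otimes_A M$. Then, up to natural equivalence, $T$ has exactly one homological presentation; precisely, the category $\mathrm{Ho}(\mathrm{HPres}(T))$ is equivalent to the category with one object and one morphism. Here a *presentation* of a monad $T$ on a category $\mathcal C$ is a category $\mathcal D$ with functors $F:\mathcal C\to\mathcal D$ and $G:\mathcal D\to\mathcal C$, an adjunction $F\dashv G$ with counit $\varepsilon$, and an isomorphism of monads $\theta: GF\cong T$. It is *homological* if for each $GF$-algebra $\rho: GFX\to X$ the pair $\varepsilon_{FX},F\rho: FGFX\rightrightarrows FX$ has a coequalizer in $\mathcal D$, and for each object $Y$ of $\mathcal D$ the canonical map $\mathrm{coeq}(\varepsilon_{FGY},FG\varepsilon_Y)\to Y$ is an isomorphism.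 A *morphism* $(\mathcal D_1,F_1,G_1,\theta_1)\to(\mathcal D_2,F_2,G_2,\theta_2)$ of presentations is a functor $H:\mathcal D_1\to\mathcal D_2$ with natural isomorphisms $HF_1\cong F_2$ and $G_2H\cong G_1$ for which the induced isomorphism $G_1F_1\cong G_2HF_1\cong G_2F_2$ is compatible with the units of the adjunctions and with $\theta_1,\theta_2$. Two such morphisms are *homotopic* if there is a natural isomorphism between the underlying functors compatible with these structure isomorphisms. $\mathrm{Ho}(\mathrm{HPres}(T))$ has the homological presentations of $T$ as objects and the homotopy classes of morphisms of presentations as morphisms. -/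

import Mathlib

open CategoryTheory CategoryTheory.Limits

universe u v₁ v₂ u₁ u₂

namespace MonadPresentation

variable {C : Type u₁} [Category.{v₁} C]

/-- A presentation of a monad `T` on `C`: a category `D` with an adjunction `F ⊣ G` between `C`
and `D`, together with an identification, as monads, of the monad `G F` of the adjunction
with `T`. -/
structure Presentation (T : Monad C) where
  /-- The category `D`. -/
  D : Type u₂
  [cat : Category.{v₂} D]
  /-- The left adjoint. -/
  F : C ⥤ D
  /-- The right adjoint. -/
  G : D ⥤ C
  /-- The adjunction. -/
  adj : F ⊣ G
  /-- The identification of the induced monad with `T`. -/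
  monadIso : adj.toMonad ≅ T

attribute [instance] Presentation.cat

namespace Presentation

variable {T : Monad C}

/-- A morphism of presentations: a functor `K` commuting, up to specified natural isomorphisms,
with the left and with the right adjoints, such that the induced isomorphism
`G₁ F₁ ≅ G₂ K F₁ ≅ G₂ F₂` respects the units (so that this is a morphism of adjunctions lying over
the identity of `C`) and the identifications with `T`. -/
@[ext]
structure Hom (P Q : Presentation.{v₁, v₂, u₁, u₂} T) where
  /-- The functor between the two categories. -/
  K : P.D ⥤ Q.D
  /-- Compatibility with the left adjoints. -/
  isoF : P.F ⋙ K ≅ Q.F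
  /-- Compatibility with the right adjoints. -/
  isoG : K ⋙ Q.G ≅ P.G
  unit_comp (X : C) : P.adj.unit.app X ≫ isoG.inv.app (P.F.obj X) ≫ Q.G.map (isoF.hom.app X) =
    Q.adj.unit.app X
  monadIso_comp (X : C) : (isoG.inv.app (P.F.obj X) ≫ Q.G.map (isoF.hom.app X)) ≫
    Q.monadIso.hom.app X = P.monadIso.hom.app X

/-- The identity morphism of a presentation. -/
def Hom.id (P : Presentation.{v₁, v₂, u₁, u₂} T) : Hom P P where
  K := 𝟭 _
  isoF := P.F.rightUnitor
  isoG := P.G.leftUnitor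
  unit_comp X := by simp
  monadIso_comp X := by
    refine Eq.trans ?_ (Category.id_comp (P.monadIso.hom.app X))
    congr 1
    simp
    rfl

/-- Composition of morphisms of presentations. -/
def Hom.comp {P Q R : Presentation.{v₁, v₂, u₁, u₂} T} (f : Hom P Q) (g : Hom Q R) : Hom P R where
  K := f.K ⋙ g.K
  isoF := (Functor.associator _ _ _).symm ≪≫ Functor.isoWhiskerRight f.isoF g.K ≪≫ g.isoF
  isoG := Functor.associator _ _ _ ≪≫ Functor.isoWhiskerLeft f.K g.isoG ≪≫ f.isoG
  unit_comp X := by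
    have h := g.isoG.inv.naturality (f.isoF.hom.app X)
    simp only [Functor.comp_map, Functor.comp_obj] at h
    simp only [← g.unit_comp X, ← f.unit_comp X]
    simp
  monadIso_comp X := by
    have h := g.isoG.inv.naturality (f.isoF.hom.app X)
    simp only [Functor.comp_map] at h
    refine Eq.trans ?_ (f.monadIso_comp X)
    rw [← g.monadIso_comp X]
    refine Eq.trans ?_ (Category.assoc _ _ _)
    congr 1
    simp [reassoc_of% h]

/-- Presentations of `T` form a (large) category. -/
instance : Category (Presentation.{v₁, v₂, u₁, u₂} T) where
  Hom := Hom
  id := Hom.id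
  comp := Hom.comp
  id_comp f := by
    refine Hom.ext rfl (heq_of_eq ?_) (heq_of_eq ?_) <;> ext X <;> simp [Hom.comp, Hom.id]
  comp_id f := by
    refine Hom.ext rfl (heq_of_eq ?_) (heq_of_eq ?_) <;> ext X <;> simp [Hom.comp, Hom.id]
  assoc f g h := by
    refine Hom.ext rfl (heq_of_eq ?_) (heq_of_eq ?_) <;> ext X <;> simp [Hom.comp]

/-- Two morphisms of presentations are homotopic if there is an invertible natural transformation
between them, i.e. a natural isomorphism between the functors that is compatible with the
structure isomorphisms. -/
def Homotopic : HomRel (Presentation.{v₁, v₂, u₁, u₂} T) := fun P Q (f g : Hom P Q) =>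
  ∃ e : f.K ≅ g.K,
    (∀ X : C, e.hom.app (P.F.obj X) ≫ g.isoF.hom.app X = f.isoF.hom.app X) ∧
    (∀ Y : P.D, Q.G.map (e.hom.app Y) ≫ g.isoG.hom.app Y = f.isoG.hom.app Y)

lemma Homotopic.comp_left {P Q R : Presentation.{v₁, v₂, u₁, u₂} T} (f : P ⟶ Q) {g g' : Q ⟶ R}
    (h : Homotopic g g') : Homotopic (f ≫ g) (f ≫ g') := by
  obtain ⟨e, h₁, h₂⟩ := h
  change ∃ e : (Hom.comp f g).K ≅ (Hom.comp f g').K, _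
  refine ⟨Functor.isoWhiskerLeft (Hom.K f) e, fun X => ?_, fun Y => ?_⟩
  · change _ ≫ (Hom.comp f g').isoF.hom.app X = (Hom.comp f g).isoF.hom.app X
    simp [Hom.comp, ← h₁]
  · change _ ≫ (Hom.comp f g').isoG.hom.app Y = (Hom.comp f g).isoG.hom.app Y
    simp only [Hom.comp, Functor.isoWhiskerLeft_hom, Functor.whiskerLeft_app, Iso.trans_hom,
      NatTrans.comp_app, Functor.associator_hom_app, Category.id_comp]
    rw [← h₂]
    exact (Category.assoc _ _ _).symm

lemma Homotopic.comp_right {P Q R : Presentation.{v₁, v₂, u₁, u₂} T} {f f' : P ⟶ Q} (g : Q ⟶ R)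
    (h : Homotopic f f') : Homotopic (f ≫ g) (f' ≫ g) := by
  obtain ⟨e, h₁, h₂⟩ := h
  change ∃ e : (Hom.comp f g).K ≅ (Hom.comp f' g).K, _
  refine ⟨Functor.isoWhiskerRight e (Hom.K g), fun X => ?_, fun Y => ?_⟩
  · change _ ≫ (Hom.comp f' g).isoF.hom.app X = (Hom.comp f g).isoF.hom.app X
    simp [Hom.comp, ← h₁]
  · have := (Hom.isoG g).hom.naturality (e.hom.app Y)
    change _ ≫ (Hom.comp f' g).isoG.hom.app Y = (Hom.comp f g).isoG.hom.app Y
    simp only [Functor.comp_map] at this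
    simp only [Hom.comp, Functor.isoWhiskerLeft_hom, Functor.isoWhiskerRight_hom,
      Functor.whiskerLeft_app, Functor.whiskerRight_app, Iso.trans_hom, NatTrans.comp_app,
      Functor.associator_hom_app, Category.id_comp]
    rw [← h₂]
    exact (Category.assoc _ _ _).symm.trans
      ((congrArg (· ≫ _) this).trans (Category.assoc _ _ _))

/-- `P` is homological: for each algebra `ρ : G F X ⟶ X` the pair `ε_{F X}, F ρ : F G F X ⇉ F X`
has a coequalizer, and for each `Y` in `D` the canonical map from the coequalizer of
`ε_{F G Y}, F G ε_Y` to `Y` is an isomorphism. -/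
structure IsHomological (P : Presentation.{v₁, v₂, u₁, u₂} T) : Prop where
  hasCoequalizer (X : P.adj.toMonad.Algebra) :
    HasCoequalizer (P.adj.counit.app (P.F.obj X.A)) (P.F.map X.a)
  isIso_desc (Y : P.D) :
    haveI : HasCoequalizer (P.adj.counit.app (P.F.obj (P.G.obj Y)))
        (P.F.map (P.G.map (P.adj.counit.app Y))) :=
      hasCoequalizer ((Monad.comparison P.adj).obj Y)
    IsIso (coequalizer.desc (f := P.adj.counit.app (P.F.obj (P.G.obj Y)))
      (g := P.F.map (P.G.map (P.adj.counit.app Y))) (P.adj.counit.app Y)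
      (P.adj.counit.naturality (P.adj.counit.app Y)).symm)

end Presentation

/-- The large category of homological presentations of `T`, a full subcategory of the category of
presentations. -/
abbrev HPres (T : Monad C) :=
  ObjectProperty.FullSubcategory
    (fun P : Presentation.{v₁, v₂, u₁, u₂} T => P.IsHomological)

/-- Homotopy of morphisms between homological presentations. -/
def hpresHomotopic (T : Monad C) : HomRel (HPres.{v₁, v₂, u₁, u₂} T) :=
  fun _ _ f g => Presentation.Homotopic f.hom g.hom

/-- The homotopy category of homological presentations: the same objects, and homotopy classes of
morphisms. -/
abbrev HoHPres (T : Monad C) := CategoryTheory.Quotient (hpresHomotopic.{v₁, v₂, u₁, u₂} T)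

/-- Homotopy is a congruence, so that morphisms in `HoHPres T` are exactly homotopy classes. -/
instance (T : Monad C) : Congruence (hpresHomotopic.{v₁, v₂, u₁, u₂} T) where
  equivalence :=
    { refl := fun f => ⟨Iso.refl _, by simp, by simp⟩
      symm := by
        rintro f g ⟨e, h₁, h₂⟩
        refine ⟨e.symm, fun X => ?_, fun Y => ?_⟩
        · simp [← h₁]
        · simp [← h₂, ← Functor.map_comp_assoc]
      trans := by
        rintro f g h ⟨e, h₁, h₂⟩ ⟨e', h₁', h₂'⟩
        exact ⟨e ≪≫ e', fun X => by simp [h₁, h₁'], fun Y => by simp [h₂, h₂']⟩ }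
  comp_left f _ _ h := Presentation.Homotopic.comp_left f.hom h
  comp_right g h := Presentation.Homotopic.comp_right g.hom h

/-- `T` is uniquely homologically presentable: the homotopy category of its homological
presentations is equivalent to the category with one object and one morphism. -/
def UniquelyHomologicallyPresentable (T : Monad C) : Prop :=
  Nonempty (HoHPres.{v₁, v₂, u₁, u₂} T ≌ Discrete PUnit.{1})

end MonadPresentation

noncomputable section

namespace FGBaseChange

variable (A B : Type u) [CommRing A] [CommRing B] [Algebra A B]

/-- Extension of scalars `M ↦ B ⊗[A] M` on finitely generated modules. -/
def extend : FGModuleCat.{u} A ⥤ FGModuleCat.{u} B :=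
  (ModuleCat.isFG B).lift
    ((ModuleCat.isFG A).ι ⋙ ModuleCat.extendScalars.{u, u, u} (algebraMap A B)) (fun M => by
      let _ : Algebra A B := (algebraMap A B).toAlgebra
      exact (inferInstance : Module.Finite B (TensorProduct A B M)))

/-- Restriction of scalars on finitely generated modules, for `B` finite over `A`. -/
def restrict [Module.Finite A B] : FGModuleCat.{u} B ⥤ FGModuleCat.{u} A :=
  (ModuleCat.isFG A).lift
    ((ModuleCat.isFG B).ι ⋙ ModuleCat.restrictScalars.{u, u, u} (algebraMap A B)) (fun M => by
      let _ : Module A M := Module.compHom M (algebraMap A B)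
      have : IsScalarTower A B M := ⟨fun a b m => by
        rw [Algebra.smul_def, mul_smul]; rfl⟩
      exact (Module.Finite.trans B M : Module.Finite A M))

/-- The induction-restriction adjunction on finitely generated modules. -/
def adj [Module.Finite A B] : extend A B ⊣ restrict A B :=
  (ModuleCat.extendRestrictScalarsAdj.{u, u, u} (algebraMap A B)).restrictFullyFaithful
    (ModuleCat.isFG A).fullyFaithfulι (ModuleCat.isFG B).fullyFaithfulι
    (Iso.refl _) (Iso.refl _)

/-- The base-change monad `M ↦ B ⊗[A] M` on finitely generated `A`-modules. -/
def monad [Module.Finite A B] : Monad (FGModuleCat.{u} A) := (adj A B).toMonad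

end FGBaseChange

end

/-! Being homological says that the comparison functor from `D` to algebras is a fully faithful
right adjoint. The coequalizers of the algebra pairs build its left adjoint, and each `Y` being the
canonical coequalizer gives full faithfulness.

Uniqueness of morphisms: two morphisms into a homological `Q` become isomorphic after comparison
with algebras, because both induce the same isomorphism of monads. Full faithfulness lifts this
isomorphism to a homotopy (`Hom.homotopic`).

Existence: the algebras themselves form a homological presentation, and every presentation maps to
it. For homological `Q` this map identifies `Q.D` with a reflective subcategory of algebras
containing the free ones. Such a subcategory is closed under equalizers, so if every algebra is an
equalizer of free ones, the map is an equivalence. Inverting it gives `P → T.Algebra → Q`.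

For rings of integers, algebras are the finitely generated `B`-modules. Each embeds in some `B ⊗ M`;
embedding the cokernel as well exhibits it as the required equalizer. -/

namespace MonadPresentation

variable {C : Type u₁} [Category.{v₁} C]

namespace Presentation

variable {T : Monad C}

/-! ### Morphisms of presentations: uniqueness up to homotopy and quasi-inverses -/

namespace Hom

variable {P Q : Presentation.{v₁, v₂, u₁, u₂} T}

/-- A morphism of presentations is compatible with the counits. -/
lemma counit_comp (f : Hom P Q) (Y : P.D) :
    Q.F.map (f.isoG.hom.app Y) ≫ f.isoF.inv.app (P.G.obj Y) ≫ f.K.map (P.adj.counit.app Y) =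
      Q.adj.counit.app (f.K.obj Y) := by
  apply (Q.adj.homEquiv _ _).injective
  have h₁ := Q.adj.unit.naturality (f.isoG.hom.app Y)
  have h₂ := f.unit_comp (P.G.obj Y)
  have h₃ := f.isoG.inv.naturality (P.adj.counit.app Y)
  have h₄ := P.adj.right_triangle_components Y
  have h₅ : Q.G.map (f.isoF.hom.app (P.G.obj Y)) ≫ Q.G.map (f.isoF.inv.app (P.G.obj Y)) = 𝟙 _ := by
    rw [← Q.G.map_comp, Iso.hom_inv_id_app, Q.G.map_id]
  simp only [Functor.id_map, Functor.comp_map, Functor.comp_obj, Functor.id_obj] at h₁ h₂ h₃ h₄ h₅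
  simp only [Adjunction.homEquiv_unit, Functor.map_comp, Functor.comp_obj, Functor.id_obj,
    Adjunction.right_triangle_components]
  rw [← reassoc_of% h₁, ← h₂]
  simp only [Category.assoc]
  rw [reassoc_of% h₅, ← h₃, reassoc_of% h₄, Iso.hom_inv_id_app]
  rfl

/-- The isomorphism of monads `G₁ F₁ ≅ G₂ F₂` induced by a morphism of presentations depends
only on the presentations. -/
lemma isoG_inv_comp_map_isoF_hom (f g : Hom P Q) (X : C) :
    f.isoG.inv.app (P.F.obj X) ≫ Q.G.map (f.isoF.hom.app X) =
      g.isoG.inv.app (P.F.obj X) ≫ Q.G.map (g.isoF.hom.app X) := by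
  have : IsIso (Q.monadIso.hom.app X) :=
    inferInstanceAs (IsIso ((MonadIso.toNatIso Q.monadIso).hom.app X))
  exact (cancel_mono (Q.monadIso.hom.app X)).mp
    ((f.monadIso_comp X).trans (g.monadIso_comp X).symm)

lemma map_isoF_inv_comp_isoG_hom (f g : Hom P Q) (X : C) :
    Q.G.map (f.isoF.inv.app X) ≫ f.isoG.hom.app (P.F.obj X) =
      Q.G.map (g.isoF.inv.app X) ≫ g.isoG.hom.app (P.F.obj X) := by
  let e (f : Hom P Q) : P.G.obj (P.F.obj X) ≅ Q.G.obj (Q.F.obj X) :=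
    (f.isoG.app (P.F.obj X)).symm ≪≫ Q.G.mapIso (f.isoF.app X)
  have : e f = e g := Iso.ext (isoG_inv_comp_map_isoF_hom f g X)
  exact congr_arg Iso.inv this

/-- Two parallel morphisms of presentations become isomorphic after composition with the
comparison functor to algebras. -/
def compComparisonIso (f g : Hom P Q) :
    f.K ⋙ Monad.comparison Q.adj ≅ g.K ⋙ Monad.comparison Q.adj :=
  NatIso.ofComponents
    (fun Y => Monad.Algebra.isoMk (f.isoG.app Y ≪≫ (g.isoG.app Y).symm) (by
      change Q.G.map (Q.F.map (f.isoG.hom.app Y ≫ g.isoG.inv.app Y)) ≫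
        Q.G.map (Q.adj.counit.app (g.K.obj Y)) = Q.G.map (Q.adj.counit.app (f.K.obj Y)) ≫
          f.isoG.hom.app Y ≫ g.isoG.inv.app Y
      have hg : Q.F.map (g.isoG.inv.app Y) ≫ Q.adj.counit.app (g.K.obj Y) =
          g.isoF.inv.app (P.G.obj Y) ≫ g.K.map (P.adj.counit.app Y) := by
        rw [← g.counit_comp Y, ← Q.F.map_comp_assoc, Iso.inv_hom_id_app, Q.F.map_id,
          Category.id_comp]
      have h₁ := f.isoG.hom.naturality (P.adj.counit.app Y)
      have h₂ := g.isoG.inv.naturality (P.adj.counit.app Y)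
      have h₃ := map_isoF_inv_comp_isoG_hom f g (P.G.obj Y)
      simp only [Functor.comp_map, Functor.comp_obj, Functor.id_obj] at h₁ h₂ h₃ hg
      rw [← Q.G.map_comp, Q.F.map_comp, Category.assoc, hg, ← f.counit_comp Y]
      simp only [Functor.map_comp, Category.assoc]
      rw [reassoc_of% h₁, reassoc_of% h₃, h₂, Iso.hom_inv_id_app_assoc]))
    (fun {Y Z} k => by
      ext
      have h₁ := f.isoG.hom.naturality k
      have h₂ := g.isoG.inv.naturality k
      change Q.G.map (f.K.map k) ≫ f.isoG.hom.app Z ≫ g.isoG.inv.app Z =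
        (f.isoG.hom.app Y ≫ g.isoG.inv.app Y) ≫ Q.G.map (g.K.map k)
      simp only [Functor.comp_map] at h₁ h₂
      rw [reassoc_of% h₁, h₂, Category.assoc])

/-- Parallel morphisms of presentations are homotopic when the comparison functor of the target
is fully faithful. -/
lemma homotopic [(Monad.comparison Q.adj).Full] [(Monad.comparison Q.adj).Faithful]
    (f g : Hom P Q) : Homotopic f g := by
  -- Postcomposition with a fully faithful functor is fully faithful, so the isomorphism over
  -- algebras lifts.
  let e := ((Functor.FullyFaithful.ofFullyFaithful
    (Monad.comparison Q.adj)).whiskeringRight _).preimageIso (compComparisonIso f g)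
  have he (Y : P.D) : Q.G.map (e.hom.app Y) = f.isoG.hom.app Y ≫ g.isoG.inv.app Y :=
    congr_arg Monad.Algebra.Hom.f
      ((Monad.comparison Q.adj).map_preimage ((compComparisonIso f g).hom.app Y))
  refine ⟨e, fun X => ?_, fun Y => ?_⟩
  · rw [← cancel_epi (f.isoF.inv.app X), Iso.inv_hom_id_app]
    apply (Q.adj.homEquiv _ _).injective
    simp only [Adjunction.homEquiv_unit, Functor.map_comp, Functor.comp_obj]
    have h := map_isoF_inv_comp_isoG_hom f g X
    have h' : Q.G.map (g.isoF.inv.app X) ≫ Q.G.map (g.isoF.hom.app X) = 𝟙 _ := by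
      rw [← Q.G.map_comp, Iso.inv_hom_id_app, Q.G.map_id]
    simp only [Functor.comp_obj] at h h'
    rw [he, Category.assoc, reassoc_of% h, Iso.hom_inv_id_app_assoc]
    simp [h']
  · rw [he, Category.assoc, Iso.inv_hom_id_app]
    simp

section Inverse

variable (f : Hom P Q) (I : Q.D ⥤ P.D) (η : 𝟭 P.D ≅ f.K ⋙ I) (ε : I ⋙ f.K ≅ 𝟭 Q.D)

/-- The functor underlying a quasi-inverse is compatible with the left adjoints. -/
def quasiInverseIsoF : Q.F ⋙ I ≅ P.F :=
  Functor.isoWhiskerRight f.isoF.symm I ≪≫ Functor.associator _ _ _ ≪≫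
    Functor.isoWhiskerLeft P.F η.symm ≪≫ P.F.rightUnitor

/-- The functor underlying a quasi-inverse is compatible with the right adjoints. -/
def quasiInverseIsoG : I ⋙ P.G ≅ Q.G :=
  Functor.isoWhiskerLeft I f.isoG.symm ≪≫ (Functor.associator _ _ _).symm ≪≫
    Functor.isoWhiskerRight ε Q.G ≪≫ Q.G.leftUnitor

/-- The quasi-inverse induces the inverse of the isomorphism `G₁ F₁ ≅ G₂ F₂` induced by `f`. The
triangle identity `h` makes the unit and counit of the equivalence cancel. -/
lemma quasiInverseIsoG_inv_comp (h : ∀ Y, f.K.map (η.hom.app Y) ≫ ε.hom.app (f.K.obj Y) = 𝟙 _)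
    (X : C) : (f.quasiInverseIsoG I ε).inv.app (Q.F.obj X) ≫
      P.G.map ((f.quasiInverseIsoF I η).hom.app X) =
      Q.G.map (f.isoF.inv.app X) ≫ f.isoG.hom.app (P.F.obj X) := by
  have h₁ := f.isoG.hom.naturality (I.map (f.isoF.inv.app X) ≫ η.inv.app (P.F.obj X))
  have h₂ := ε.inv.naturality (f.isoF.inv.app X)
  have h₃ : ε.inv.app (f.K.obj (P.F.obj X)) ≫ f.K.map (η.inv.app (P.F.obj X)) = 𝟙 _ := by
    let e : f.K.obj (P.F.obj X) ≅ f.K.obj (P.F.obj X) :=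
      f.K.mapIso (η.app (P.F.obj X)) ≪≫ ε.app (f.K.obj (P.F.obj X))
    have he : e = Iso.refl _ := Iso.ext (h _)
    exact congr_arg Iso.inv he
  simp only [Functor.comp_map, Functor.comp_obj, Functor.id_obj, Functor.id_map] at h₁ h₂ h₃
  simp only [quasiInverseIsoG, quasiInverseIsoF, Iso.trans_inv, Iso.trans_hom, NatTrans.comp_app,
    Functor.isoWhiskerLeft_inv, Functor.isoWhiskerRight_inv, Functor.isoWhiskerRight_hom,
    Functor.isoWhiskerLeft_hom, Functor.whiskerLeft_app, Functor.whiskerRight_app, Iso.symm_hom,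
    Iso.symm_inv, Functor.associator_hom_app, Functor.leftUnitor_inv_app,
    Functor.rightUnitor_hom_app, Category.id_comp, Category.comp_id, Category.assoc,
    Functor.comp_obj, Functor.id_obj]
  rw [← h₁, ← Q.G.map_comp_assoc, f.K.map_comp, ← reassoc_of% h₂, h₃, Category.comp_id]

/-- A quasi-inverse of a morphism of presentations whose underlying functor is an equivalence. -/
def quasiInverse (h : ∀ Y, f.K.map (η.hom.app Y) ≫ ε.hom.app (f.K.obj Y) = 𝟙 _) : Hom Q P where
  K := I
  isoF := f.quasiInverseIsoF I η
  isoG := f.quasiInverseIsoG I ε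
  unit_comp X := by
    rw [f.quasiInverseIsoG_inv_comp I η ε h, ← f.unit_comp X]
    simp [← Functor.map_comp_assoc]
  monadIso_comp X := by
    refine (congr_arg (· ≫ P.monadIso.hom.app X)
      (f.quasiInverseIsoG_inv_comp I η ε h X)).trans ?_
    have h : (Q.G.map (f.isoF.inv.app X) ≫ f.isoG.hom.app (P.F.obj X)) ≫
        (f.isoG.inv.app (P.F.obj X) ≫ Q.G.map (f.isoF.hom.app X)) = 𝟙 _ := by
      simp [← Functor.map_comp]
    rw [← f.monadIso_comp X]
    refine (Category.assoc _ _ _).symm.trans ((congr_arg (· ≫ _) h).trans (Category.id_comp _))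

end Inverse

lemma nonempty_symm (f : Hom P Q) [f.K.IsEquivalence] : Nonempty (Hom Q P) :=
  ⟨f.quasiInverse f.K.inv f.K.asEquivalence.unitIso f.K.asEquivalence.counitIso
    f.K.asEquivalence.functor_unitIso_comp⟩

end Hom

/-! ### The presentation by algebras -/

variable (T) in
/-- The presentation of a monad by its category of algebras. -/
def eilenbergMoore : Presentation.{v₁, v₁, u₁, max u₁ v₁} T where
  D := T.Algebra
  F := T.free
  G := T.forget
  adj := T.adj
  monadIso := Adjunction.adjToMonadIso T

lemma hasCoequalizer_symm {D : Type u₂} [Category.{v₂} D] {X Y : D} {f g : X ⟶ Y}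
    (h : HasCoequalizer f g) : HasCoequalizer g f :=
  HasColimit.mk ⟨Cofork.ofπ (coequalizer.π f g) (coequalizer.condition f g).symm,
    Cofork.IsColimit.mk _ (fun s => coequalizer.desc s.π s.condition.symm)
      (fun _ => coequalizer.π_desc _ _)
      (fun _ _ hm => coequalizer.hom_ext (hm.trans (coequalizer.π_desc _ _).symm))⟩

lemma isIso_coequalizer_desc {D : Type u₂} [Category.{v₂} D] {X Y Z : D} {f g : X ⟶ Y}
    {_ : HasCoequalizer f g} {p : Y ⟶ Z} {w : f ≫ p = g ≫ p} (h : IsColimit (Cofork.ofπ p w)) :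
    IsIso (coequalizer.desc p w) :=
  (IsColimit.coconePointUniqueUpToIso (colimit.isColimit _) h).isIso_hom

/-- Beck's canonical presentation of an algebra by free ones, with the parallel pair in the order
used by `IsHomological`. The map `k` is kept separate because the applications match it with `Y.a`
only up to a proof. -/
lemma exists_isColimit_cofork (T : Monad C) (Y : T.Algebra) {k : T.obj Y.A ⟶ Y.A}
    (hk : k = Y.a) : ∃ w : T.adj.counit.app (T.free.obj Y.A) ≫ T.adj.counit.app Y =
      T.free.map k ≫ T.adj.counit.app Y, Nonempty (IsColimit (Cofork.ofπ _ w)) := by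
  subst hk
  have h₁ : T.adj.counit.app Y = Monad.FreeCoequalizer.π Y := by
    ext; simp; rfl
  have h₂ : T.adj.counit.app (T.free.obj Y.A) = Monad.FreeCoequalizer.bottomMap Y := by
    ext; simp; rfl
  have key : ∃ w : Monad.FreeCoequalizer.bottomMap Y ≫ Monad.FreeCoequalizer.π Y =
      Monad.FreeCoequalizer.topMap Y ≫ Monad.FreeCoequalizer.π Y,
      Nonempty (IsColimit (Cofork.ofπ _ w)) := by
    refine ⟨(Monad.FreeCoequalizer.condition Y).symm, ⟨?_⟩⟩
    have h := Monad.beckAlgebraCoequalizer Y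
    exact Cofork.IsColimit.mk _
      (fun s => Cofork.IsColimit.desc h s.π s.condition.symm)
      (fun s => Cofork.IsColimit.π_desc' h _ _)
      (fun s m hm => Cofork.IsColimit.hom_ext h
        (hm.trans (Cofork.IsColimit.π_desc' h _ s.condition.symm).symm))
  rw [h₁, h₂]
  exact key

lemma eilenbergMoore_isHomological : (eilenbergMoore T).IsHomological where
  hasCoequalizer X := by
    let Y : T.Algebra := (Monad.algebraEquivOfIsoMonads (Adjunction.adjToMonadIso T)).functor.obj X
    obtain ⟨w, ⟨h⟩⟩ := exists_isColimit_cofork T Y (Category.id_comp X.a).symm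
    exact HasColimit.mk ⟨_, h⟩
  isIso_desc Y := by
    obtain ⟨w, ⟨h⟩⟩ := exists_isColimit_cofork T Y
      (k := T.forget.map (T.adj.counit.app Y)) (by simp; rfl)
    exact isIso_coequalizer_desc (D := T.Algebra) h

variable {P : Presentation.{v₁, v₁, u₁, u₂} T}

lemma map_monadIso_hom_comp_μ {S : Monad C} (i : S ≅ T) (X : C) :
    T.map (i.hom.app X) ≫ T.μ.app X =
      (i.inv.app (S.obj X) ≫ S.μ.app X) ≫ i.hom.app X := by
  have h : i.inv.app (S.obj X) ≫ i.hom.app (S.obj X) = 𝟙 _ :=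
    (MonadIso.toNatIso i).inv_hom_id_app _
  have h' : S.map (i.hom.app X) ≫ i.hom.app (T.obj X) =
      i.hom.app (S.obj X) ≫ T.map (i.hom.app X) := (MonadIso.toNatIso i).hom.naturality _
  rw [Category.assoc, i.hom.app_μ, h', Category.assoc, reassoc_of% h]

/-- The comparison morphism from a presentation to the presentation by algebras. -/
def toEilenbergMoore (P : Presentation.{v₁, v₁, u₁, max u₁ v₁} T) : Hom P (eilenbergMoore T) where
  K := Monad.comparison P.adj ⋙ (Monad.algebraEquivOfIsoMonads P.monadIso).functor
  isoF := NatIso.ofComponents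
    (fun X => Monad.Algebra.isoMk ((MonadIso.toNatIso P.monadIso).app X) (by
      change T.map (P.monadIso.hom.app X) ≫ T.μ.app X =
        (P.monadIso.inv.app _ ≫ P.G.map (P.adj.counit.app (P.F.obj X))) ≫ P.monadIso.hom.app X
      exact map_monadIso_hom_comp_μ P.monadIso X))
    (by
      intro X Y f
      apply Monad.Algebra.Hom.ext
      exact (MonadIso.toNatIso P.monadIso).hom.naturality f)
  isoG := Iso.refl _
  unit_comp X := by
    have h : P.adj.unit.app X ≫ P.monadIso.hom.app X = T.η.app X := P.monadIso.hom.app_η X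
    change P.adj.unit.app X ≫ 𝟙 _ ≫ P.monadIso.hom.app X = T.adj.unit.app X
    refine (congr_arg (_ ≫ ·) (Category.id_comp _)).trans (h.trans ?_)
    simp
  monadIso_comp X := by
    change (𝟙 _ ≫ P.monadIso.hom.app X) ≫ 𝟙 _ = P.monadIso.hom.app X
    exact (Category.comp_id _).trans (Category.id_comp _)

/-! ### The comparison functor of a homological presentation -/

lemma IsHomological.isRightAdjoint_comparison (h : P.IsHomological) :
    (Monad.comparison P.adj).IsRightAdjoint := by
  have (X : P.adj.toMonad.Algebra) :
      HasCoequalizer (P.F.map X.a) (P.adj.counit.app (P.F.obj X.A)) :=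
    hasCoequalizer_symm (h.hasCoequalizer X)
  exact (Monad.MonadicityInternal.comparisonAdjunction P.adj).isRightAdjoint

lemma IsHomological.nonempty_isColimit (h : P.IsHomological) (Y : P.D) :
    Nonempty (IsColimit (Cofork.ofπ (f := P.adj.counit.app (P.F.obj (P.G.obj Y)))
      (g := P.F.map (P.G.map (P.adj.counit.app Y))) (P.adj.counit.app Y)
      (P.adj.counit.naturality (P.adj.counit.app Y)).symm)) := by
  have : HasCoequalizer (P.adj.counit.app (P.F.obj (P.G.obj Y)))
      (P.F.map (P.G.map (P.adj.counit.app Y))) :=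
    h.hasCoequalizer ((Monad.comparison P.adj).obj Y)
  have h' := h.isIso_desc Y
  exact ⟨IsColimit.ofPointIso (colimit.isColimit _) (i := h')⟩

/-- The counit at `Y` is a coequalizer, hence epi, and by naturality its composite with `f` depends
only on `G f`. -/
lemma IsHomological.faithful_comparison (h : P.IsHomological) :
    (Monad.comparison P.adj).Faithful where
  map_injective {Y Z f g} hfg := by
    have hfg : P.G.map f = P.G.map g := congr_arg Monad.Algebra.Hom.f hfg
    obtain ⟨hY⟩ := h.nonempty_isColimit Y
    apply Cofork.IsColimit.hom_ext hY
    have h₁ := P.adj.counit.naturality f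
    have h₂ := P.adj.counit.naturality g
    simp only [Functor.comp_map, Functor.id_map] at h₁ h₂
    exact h₁.symm.trans ((congr_arg (P.F.map · ≫ _) hfg).trans h₂)

/-- For an algebra map `k`, the map `F k ≫ ε_Z` coequalizes the canonical pair of `Y`. Its descent
to `Y ⟶ Z` is the preimage, as transposing along the unit shows. -/
lemma IsHomological.full_comparison (h : P.IsHomological) :
    (Monad.comparison P.adj).Full where
  map_surjective {Y Z} k := by
    let k' : P.G.obj Y ⟶ P.G.obj Z := k.f
    have hk : P.G.map (P.F.map k') ≫ P.G.map (P.adj.counit.app Z) =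
      P.G.map (P.adj.counit.app Y) ≫ k' := k.h
    obtain ⟨hY⟩ := h.nonempty_isColimit Y
    obtain ⟨l, hl⟩ := Cofork.IsColimit.desc' hY (P.F.map k' ≫ P.adj.counit.app Z) (by
      rw [← P.F.map_comp_assoc, ← hk]
      simp)
    refine ⟨l, ?_⟩
    ext
    have h₁ := P.adj.unit.app (P.G.obj Y) ≫= congr_arg P.G.map hl
    simp at h₁
    exact h₁

end Presentation

/-! ### Equalizers of free algebras and the abstract criterion -/

/-- The essential image of a fully faithful right adjoint is closed under equalizers. -/
lemma mem_essImage_of_isLimit_fork {D : Type*} {E : Type*} [Category* D] [Category* E]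
    (R : D ⥤ E) [R.IsRightAdjoint] [R.Full] [R.Faithful] {X Y Z : E} {f g : Y ⟶ Z} {i : X ⟶ Y}
    (w : i ≫ f = i ≫ g) (hi : IsLimit (Fork.ofι i w)) (hY : R.essImage Y) (hZ : R.essImage Z) :
    R.essImage X := by
  let _ : Reflective R := { L := R.leftAdjoint, adj := Adjunction.ofIsRightAdjoint R }
  let η := (reflectorAdjunction R).unit.app X
  let r := unitCompPartialBijective X hY i
  have hr : η ≫ r = i := by
    rw [← unitCompPartialBijective_symm_apply X hY, Equiv.symm_apply_apply]
  have hr' : r ≫ f = r ≫ g := by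
    apply (unitCompPartialBijective X hZ).symm.injective
    simp only [unitCompPartialBijective_symm_apply]
    change η ≫ r ≫ f = η ≫ r ≫ g
    rw [reassoc_of% hr, w, reassoc_of% hr]
  -- The extension `r` of `i` along the unit still equalizes `f` and `g`, so it factors through `X`;
  -- this factorization retracts the unit.
  have : IsSplitMono η := ⟨⟨Fork.IsLimit.lift hi r hr', by
    apply Fork.IsLimit.hom_ext hi
    rw [Category.assoc]
    exact (congr_arg (η ≫ ·) (Fork.IsLimit.lift_ι' hi r hr')).trans
      (hr.trans (Category.id_comp _).symm)⟩⟩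
  exact mem_essImage_of_unit_isSplitMono

/-- Every algebra is an equalizer of a pair of morphisms between free algebras. -/
def AlgebrasAreEqualizersOfFree (T : Monad C) : Prop :=
  ∀ X : T.Algebra, ∃ (M N : C) (f g : T.free.obj M ⟶ T.free.obj N) (i : X ⟶ T.free.obj M)
    (w : i ≫ f = i ≫ g), Nonempty (IsLimit (Fork.ofι i w))

lemma Presentation.IsHomological.isEquivalence {T : Monad C} (hT : AlgebrasAreEqualizersOfFree T)
    {P : Presentation.{v₁, v₁, u₁, max u₁ v₁} T} (hP : P.IsHomological) :
    P.toEilenbergMoore.K.IsEquivalence := by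
  have := hP.faithful_comparison
  have := hP.full_comparison
  have := hP.isRightAdjoint_comparison
  let K : P.D ⥤ T.Algebra :=
    Monad.comparison P.adj ⋙ (Monad.algebraEquivOfIsoMonads P.monadIso).functor
  have hfree (M : C) : K.essImage (T.free.obj M) :=
    ⟨P.F.obj M, ⟨P.toEilenbergMoore.isoF.app M⟩⟩
  have : K.EssSurj := ⟨fun X => by
    obtain ⟨M, N, f, g, i, w, ⟨hi⟩⟩ := hT X
    exact mem_essImage_of_isLimit_fork _ w hi (hfree M) (hfree N)⟩
  have hK : K.IsEquivalence := { }
  exact hK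

/-- A monad all of whose algebras are equalizers of free algebras is uniquely homologically
presentable. -/
theorem uniquelyHomologicallyPresentable {T : Monad C} (hT : AlgebrasAreEqualizersOfFree T) :
    UniquelyHomologicallyPresentable.{v₁, v₁, u₁, max u₁ v₁} T := by
  let Φ := Functor.star.{0} (HoHPres.{v₁, v₁, u₁, max u₁ v₁} T)
  have : Φ.EssSurj := ⟨fun _ =>
    ⟨⟨⟨Presentation.eilenbergMoore T, Presentation.eilenbergMoore_isHomological⟩⟩,
      ⟨Discrete.eqToIso rfl⟩⟩⟩
  have : Φ.Faithful := ⟨fun {P Q f g} _ => by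
    obtain ⟨⟨P, hP⟩⟩ := P
    obtain ⟨⟨Q, hQ⟩⟩ := Q
    induction f using Quot.ind with | mk f
    induction g using Quot.ind with | mk g
    have := hQ.faithful_comparison
    have := hQ.full_comparison
    exact CategoryTheory.Quotient.sound _ (Presentation.Hom.homotopic f.hom g.hom)⟩
  have : Φ.Full := ⟨fun {P Q} f => by
    obtain ⟨⟨P, hP⟩⟩ := P
    obtain ⟨⟨Q, hQ⟩⟩ := Q
    have := hQ.isEquivalence hT
    obtain ⟨g⟩ := Q.toEilenbergMoore.nonempty_symm
    exact ⟨(CategoryTheory.Quotient.functor _).map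
      (ObjectProperty.homMk (P.toEilenbergMoore.comp g)), Subsingleton.elim _ _⟩⟩
  have : Φ.IsEquivalence := { }
  exact ⟨Φ.asEquivalence⟩

end MonadPresentation

/-! ### Embedding modules over a Dedekind domain into extended modules -/

noncomputable section
section

variable (A : Type*) {B N : Type*} [CommRing A] [CommRing B] [Algebra A B] [IsDedekindDomain B]
  [AddCommGroup N] [Module B N] [Module.Finite B N]

/-- A finitely generated torsion-free module over a Dedekind domain embeds into a free module. -/
theorem Module.exists_injective_of_isTorsionFree [Module.IsTorsionFree B N] :
    ∃ (n : ℕ) (f : N →ₗ[B] (Fin n → B)), Function.Injective f := by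
  have := Module.finitePresentation_of_finite B N
  have : Module.Projective B N := Module.Flat.projective_of_finitePresentation
  obtain ⟨n, p, hp⟩ := Module.Finite.exists_fin' B N
  obtain ⟨g, hg⟩ := Module.projective_lifting_property p LinearMap.id hp
  exact ⟨n, g, Function.LeftInverse.injective (g := p) fun x => LinearMap.congr_fun hg x⟩

/-- A finitely generated module over a Dedekind domain killed by a nonzero scalar `a` embeds into
a free `B ⧸ (a)`-module. -/
theorem Module.exists_injective_of_smul_eq_zero {a : B} (ha : a ≠ 0) (h : ∀ x : N, a • x = 0) :
    ∃ (n : ℕ) (f : N →ₗ[B] (Fin n → B ⧸ Ideal.span {a})), Function.Injective f := by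
  obtain ⟨n, p, hp⟩ := Module.Finite.exists_fin' B N
  let P := LinearMap.ker p
  have := Module.finitePresentation_of_finite B P
  have : Module.Projective B P := Module.Flat.projective_of_finitePresentation
  obtain ⟨m, q, hq⟩ := Module.Finite.exists_fin' B P
  obtain ⟨g, hg⟩ := Module.projective_lifting_property q LinearMap.id hq
  have hqg (x : P) : q (g x) = x := LinearMap.congr_fun hg x
  -- Since `a` kills `N`, multiplication by `a` sends the free cover into the relations `P`.
  let s : (Fin n → B) →ₗ[B] P := (a • LinearMap.id).codRestrict P (fun x => by simp [P, h])
  let π : (Fin m → B) →ₗ[B] (Fin m → B ⧸ Ideal.span {a}) :=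
    LinearMap.pi fun i => (Ideal.span {a}).mkQ ∘ₗ LinearMap.proj i
  have hπ (y : Fin m → B) : π y = 0 ↔ ∃ z, a • z = y := by
    have : π y = 0 ↔ ∀ i, a ∣ y i := by
      simp [π, funext_iff, Ideal.Quotient.eq_zero_iff_mem, Ideal.mem_span_singleton]
    rw [this]
    exact ⟨fun h => ⟨fun i => (h i).choose, funext fun i => (h i).choose_spec.symm⟩,
      fun ⟨z, hz⟩ i => ⟨z i, (congr_fun hz i).symm⟩⟩
  -- As `g` is split by `q`, the kernel consists of those `x` with `a • x ∈ a • P`, that is, of `P`.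
  -- Hence `N` embeds in `P / aP`, inside `(B / a)^m`.
  have hk : LinearMap.ker (π ∘ₗ g ∘ₗ s) = P := by
    ext x
    rw [LinearMap.mem_ker, LinearMap.comp_apply, hπ]
    constructor
    · rintro ⟨z, hz⟩
      have h₁ : a • (q z : Fin n → B) = a • x := by
        simpa [hqg, s] using congr_arg (fun y => (q y : Fin n → B)) hz
      rw [← smul_right_injective _ ha h₁]
      exact (q z).2
    · intro hx
      refine ⟨g ⟨x, hx⟩, ?_⟩
      rw [← map_smul]
      rfl
  let e := p.quotKerEquivOfSurjective hp
  have hl : Function.Injective (P.liftQ (π ∘ₗ g ∘ₗ s) hk.ge) := by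
    rw [← LinearMap.ker_eq_bot, Submodule.ker_liftQ_eq_bot _ _ _ hk.le]
  exact ⟨m, (P.liftQ (π ∘ₗ g ∘ₗ s) hk.ge) ∘ₗ e.symm.toLinearMap, hl.comp e.symm.injective⟩

variable (B N) in
/-- The torsion of a finitely generated module is killed by a single nonzero scalar, which may be
taken from the base of an integral extension. -/
theorem Module.exists_smul_mem_torsion_eq_zero [Nontrivial A] [Algebra.IsIntegral A B] :
    ∃ a : A, a ≠ 0 ∧ ∀ x ∈ Submodule.torsion B N, algebraMap A B a • x = 0 := by
  obtain ⟨b, hb, hb'⟩ := Submodule.annihilator_top_inter_nonZeroDivisors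
    (Submodule.torsion_isTorsion (R := B) (M := N))
  -- The annihilator of the torsion is nonzero, and in an integral extension a nonzero regular
  -- element forces a nonzero contraction to `A`.
  have hI := Ideal.comap_ne_bot_of_integral_mem (nonZeroDivisors.ne_zero hb') hb
    (Algebra.IsIntegral.isIntegral (R := A) b)
  obtain ⟨a, ha, ha'⟩ := Submodule.exists_mem_ne_zero_of_ne_bot hI
  refine ⟨a, ha', fun x hx => ?_⟩
  exact congr_arg Subtype.val (Submodule.mem_annihilator.mp (Ideal.mem_comap.mp ha)
    (⟨x, hx⟩ : Submodule.torsion B N) trivial)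

open TensorProduct in
/-- Over a Dedekind domain integral over `A`, every finitely generated module embeds into one
extended from a finitely generated `A`-module. -/
theorem Module.exists_injective_tensorProduct [Nontrivial A] [FaithfulSMul A B]
    [Algebra.IsIntegral A B] :
    ∃ (m n : ℕ) (a : A) (f : N →ₗ[B] B ⊗[A] ((Fin m → A) × (Fin n → A ⧸ Ideal.span {a}))),
      Function.Injective f := by
  obtain ⟨a, ha, ht⟩ := Module.exists_smul_mem_torsion_eq_zero A B N
  let b := algebraMap A B a
  have hb : b ≠ 0 := by
    simpa [b] using ha
  let t := Submodule.torsion B N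
  let r := LinearMap.range (b • (LinearMap.id : N →ₗ[B] N))
  obtain ⟨m, f, hf⟩ := Module.exists_injective_of_isTorsionFree (B := B) (N := N ⧸ t)
  obtain ⟨n, g, hg⟩ := Module.exists_injective_of_smul_eq_zero (N := N ⧸ r) hb (fun x => by
    obtain ⟨x, rfl⟩ := r.mkQ_surjective x
    rw [← map_smul]
    exact (Submodule.Quotient.mk_eq_zero _).mpr ⟨x, rfl⟩)
  have hmap : Ideal.span {b} = (Ideal.span {a}).map (algebraMap A B) := by
    rw [Ideal.map_span, Set.image_singleton]
  let e₁ : B ≃ₗ[B] B ⊗[A] A := (AlgebraTensorModule.rid A B B).symm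
  let e₂ : (B ⧸ Ideal.span {b}) ≃ₗ[B] B ⊗[A] (A ⧸ Ideal.span {a}) :=
    Submodule.quotEquivOfEq _ _ hmap ≪≫ₗ Ideal.qoutMapEquivTensorQout B
  let e : ((Fin m → B) × (Fin n → B ⧸ Ideal.span {b})) ≃ₗ[B]
      B ⊗[A] ((Fin m → A) × (Fin n → A ⧸ Ideal.span {a})) :=
    (LinearEquiv.prodCongr
      (LinearEquiv.piCongrRight (fun _ => e₁) ≪≫ₗ (piRight A B B (fun _ => A)).symm)
      (LinearEquiv.piCongrRight (fun _ => e₂) ≪≫ₗ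
        (piRight A B B (fun _ => A ⧸ Ideal.span {a})).symm)) ≪≫ₗ (prodRight A B B _ _).symm
  have hfg : Function.Injective ((f ∘ₗ t.mkQ).prod (g ∘ₗ r.mkQ)) := by
    rw [injective_iff_map_eq_zero]
    intro x hx
    obtain ⟨h₁, h₂⟩ := Prod.ext_iff.mp hx
    have h₁ : x ∈ t := (Submodule.Quotient.mk_eq_zero _).mp
      ((injective_iff_map_eq_zero f).mp hf _ h₁)
    obtain ⟨y, rfl⟩ : x ∈ r := (Submodule.Quotient.mk_eq_zero _).mp
      ((injective_iff_map_eq_zero g).mp hg _ h₂)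
    -- The kernel is `t ∩ bN`. If `b • y` is torsion then so is `y`, and `b` kills torsion.
    refine ht y ?_
    obtain ⟨c, hc⟩ := (Submodule.mem_torsion_iff _).mp h₁
    refine (Submodule.mem_torsion_iff _).mpr
      ⟨c * ⟨b, mem_nonZeroDivisors_of_ne_zero hb⟩, ?_⟩
    rw [mul_smul]
    exact hc
  exact ⟨m, n, a, e.toLinearMap ∘ₗ _, e.injective.comp hfg⟩

end

/-! ### Monadicity and the base-change monad -/

namespace FGBaseChange

variable (A B : Type u) [CommRing A] [CommRing B] [Algebra A B]

/-- Crude monadicity: restriction of scalars reflects isomorphisms and preserves coequalizers. Both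
are inherited from all modules through the inclusions of finitely generated ones. -/
theorem isEquivalence_comparison [Module.Finite A B] [IsNoetherianRing A] [IsNoetherianRing B] :
    (Monad.comparison (adj A B)).IsEquivalence := by
  have h₁ : (restrict A B).ReflectsIsomorphisms := by
    have : (restrict A B ⋙ (ModuleCat.isFG A).ι).ReflectsIsomorphisms :=
      inferInstanceAs ((ModuleCat.isFG B).ι ⋙
        ModuleCat.restrictScalars (algebraMap A B)).ReflectsIsomorphisms
    exact reflectsIsomorphisms_of_comp _ (ModuleCat.isFG A).ι
  have : PreservesColimitsOfShape WalkingParallelPair ((ModuleCat.isFG B).ι) :=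
    inferInstanceAs (PreservesColimitsOfShape WalkingParallelPair
      (forget₂ (FGModuleCat B) (ModuleCat B)))
  have : PreservesColimitsOfShape WalkingParallelPair
      (ModuleCat.restrictScalars.{u} (algebraMap A B)) :=
    ⟨ModuleCat.preservesColimit_restrictScalars _ _⟩
  have : PreservesColimitsOfShape WalkingParallelPair (restrict A B) := by
    have : PreservesColimitsOfShape WalkingParallelPair (restrict A B ⋙ (ModuleCat.isFG A).ι) :=
      inferInstanceAs (PreservesColimitsOfShape WalkingParallelPair ((ModuleCat.isFG B).ι ⋙
        ModuleCat.restrictScalars (algebraMap A B)))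
    exact preservesColimitsOfShape_of_reflects_of_preserves _ (ModuleCat.isFG A).ι
  have : Monad.PreservesColimitOfIsReflexivePair (restrict A B) := ⟨fun _ _ => inferInstance⟩
  exact (Monad.monadicOfHasPreservesReflexiveCoequalizersOfReflectsIsomorphisms (adj A B)).eqv

theorem exists_mono_extend [Module.Finite A B] [IsDedekindDomain B] [Nontrivial A]
    [FaithfulSMul A B] (N : FGModuleCat.{u} B) :
    ∃ (M : FGModuleCat.{u} A) (i : N ⟶ (extend A B).obj M), Mono i := by
  have hA : (algebraMap A B).IsIntegral := algebraMap_isIntegral_iff.mpr inferInstance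
  have hA' := FaithfulSMul.algebraMap_injective A B
  -- `extend` builds its tensor product from the action of `A` on `B` through the ring map, so the
  -- embedding is taken for that algebra structure.
  let _ : Algebra A B := (algebraMap A B).toAlgebra
  have : Algebra.IsIntegral A B := ⟨hA⟩
  have : FaithfulSMul A B := (faithfulSMul_iff_algebraMap_injective A B).mpr hA'
  obtain ⟨m, n, a, f, hf⟩ := Module.exists_injective_tensorProduct A (B := B) (N := N)
  let M := (Fin m → A) × (Fin n → A ⧸ Ideal.span {a})
  refine ⟨FGModuleCat.of A M,
    ObjectProperty.homMk (ModuleCat.ofHom (Y := TensorProduct A B M) f), ?_⟩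
  have : Mono (ModuleCat.ofHom f) := (ModuleCat.mono_iff_injective _).mpr hf
  exact (ModuleCat.isFG B).ι.mono_of_mono_map this

theorem algebrasAreEqualizersOfFree_monad [Module.Finite A B] [IsNoetherianRing A]
    [IsDedekindDomain B] [Nontrivial A] [FaithfulSMul A B] :
    MonadPresentation.AlgebrasAreEqualizersOfFree (monad A B) := by
  intro X
  have := isEquivalence_comparison A B
  let K : FGModuleCat.{u} B ⥤ (monad A B).Algebra := Monad.comparison (adj A B)
  have : K.IsEquivalence := this
  let N := K.objPreimage X
  let e : K.obj N ≅ X := K.objObjPreimageIso X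
  obtain ⟨M, i, _⟩ := exists_mono_extend A B N
  obtain ⟨M', j, _⟩ := exists_mono_extend A B (cokernel i)
  have w : i ≫ (cokernel.π i ≫ j) = i ≫ 0 := by simp
  -- `i` is the kernel of its cokernel map, and remains the kernel after composing with the mono
  -- `j`; a kernel is an equalizer with `0`.
  have hi : IsLimit (Fork.ofι i w) :=
    isKernelCompMono (Abelian.monoIsKernelOfCokernel _ (cokernelIsCokernel i)) j rfl
  have hK := isLimitForkMapOfIsLimit K w hi
  have w' : (e.inv ≫ K.map i) ≫ K.map (cokernel.π i ≫ j) = (e.inv ≫ K.map i) ≫ K.map 0 := by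
    rw [Category.assoc, Category.assoc, ← K.map_comp, ← K.map_comp, w]
  exact ⟨M, M', K.map (cokernel.π i ≫ j), K.map 0, e.inv ≫ K.map i, w',
    ⟨hK.ofIsoLimit (Fork.ext e (e.hom_inv_id_assoc _))⟩⟩

end FGBaseChange

end

open NumberField in
theorem mainTheorem7 (K L : Type u) [Field K] [NumberField K] [Field L] [NumberField L]
    [Algebra K L] :
    MonadPresentation.UniquelyHomologicallyPresentable.{u, u, u + 1, u + 1}
      (FGBaseChange.monad (𝓞 K) (𝓞 L)) :=
  MonadPresentation.uniquelyHomologicallyPresentable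
    (FGBaseChange.algebrasAreEqualizersOfFree_monad (𝓞 K) (𝓞 L))
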